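/- For every integer $k\ge 0$ there is a constant $A_k$, depending only on $k$, with the following property. Let $n\ge 0$, let $\Sigma$ be a fan in $\mathbb R^n$ with respect to the lattice $\mathbb Z^n$ whose toric variety $X=X_\Sigma$ is a smooth toric Fano variety (that is, $\Sigma$ is smooth and complete and the anticanonical divisor $-K_X$ is ample), and suppose that $\Sigma$ has a primitive relation of the form $$v_1+\dots+v_{n+1-k}=0,$$ that is, there are $n+1-k$ distinct primitive ray generators $v_1,\dots,v_{n+1-k}$ of $\Sigma$ with sum $0$ which together do not span a cone of $\Sigma$, while every proper subset of them spans a cone of $\Sigma$. Then the Picard rank satisfies $\rho(X)\le A_k$. In particular the bound does not depend on the dimension $n$. -/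

import Mathlib

noncomputable section

/-- The real vector in `N_ℝ = ℝⁿ` underlying a vector of the lattice `N = ℤⁿ`. -/
def latticeVec {n : ℕ} (v : Fin n → ℤ) : Fin n → ℝ := fun i => (v i : ℝ)

/-- The cone `⟨S⟩ ⊆ ℝⁿ` generated over `ℝ≥0` by a set `S` of lattice vectors. -/
def latticeCone {n : ℕ} (S : Set (Fin n → ℤ)) : PointedCone ℝ (Fin n → ℝ) :=
  PointedCone.hull ℝ (latticeVec '' S)

/-- A lattice vector is primitive if it is not a multiple of a lattice vector by a non-unit integer
(in particular it is nonzero). -/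
def IsPrimitiveVec {n : ℕ} (v : Fin n → ℤ) : Prop :=
  ∀ (d : ℤ) (w : Fin n → ℤ), v = d • w → IsUnit d

/-- A fan in `ℝⁿ` with respect to the lattice `ℤⁿ`: a finite nonempty collection of strongly convex
rational polyhedral cones, closed under passing to faces, and such that any two of its cones
intersect in a common face. It encodes the normal toric variety `X_Σ` of dimension `n`. -/
structure ToricFan (n : ℕ) where
  /-- The cones of the fan. -/
  cones : Set (PointedCone ℝ (Fin n → ℝ))
  finite : cones.Finite
  nonempty : cones.Nonempty
  rational : ∀ σ ∈ cones, ∃ S : Finset (Fin n → ℤ), σ = latticeCone (S : Set (Fin n → ℤ))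
  stronglyConvex : ∀ σ ∈ cones, ∀ x ∈ σ, -x ∈ σ → x = 0
  face_mem : ∀ σ ∈ cones, ∀ τ : PointedCone ℝ (Fin n → ℝ), τ.IsFaceOf σ → τ ∈ cones
  inter_face : ∀ σ ∈ cones, ∀ τ ∈ cones, (σ ⊓ τ).IsFaceOf σ ∧ (σ ⊓ τ).IsFaceOf τ

namespace ToricFan

variable {n : ℕ} (F : ToricFan n)

/-- `G(Σ)`: the primitive generators of the rays (one-dimensional cones) of the fan. They index the
torus-invariant prime divisors `D_v` of `X_Σ`. -/
def rayGens : Set (Fin n → ℤ) := {v | IsPrimitiveVec v ∧ latticeCone {v} ∈ F.cones}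

/-- The fan is smooth (equivalently, `X_Σ` is smooth): each cone is generated by a part of a
`ℤ`-basis of the lattice. -/
def IsSmooth : Prop :=
  ∀ σ ∈ F.cones, ∃ (b : Module.Basis (Fin n) ℤ (Fin n → ℤ)) (I : Set (Fin n)),
    σ = latticeCone (b '' I)

/-- The fan is complete (equivalently, `X_Σ` is complete): its cones cover `ℝⁿ`. -/
def IsComplete : Prop := ∀ x : Fin n → ℝ, ∃ σ ∈ F.cones, x ∈ σ

/-! ### Torus-invariant divisors -/

/-- Torus-invariant Weil divisors `∑ a_v D_v` on `X_Σ`, as families of integers `(a_v)` indexed by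
`v ∈ G(Σ)`. -/
abbrev TDivisor : Type := F.rayGens → ℤ

/-- The divisor `∑ ⟨m, v⟩ D_v` of the character `χ^m`, for `m` in the dual lattice `M`. -/
def charDiv : Module.Dual ℤ (Fin n → ℤ) →ₗ[ℤ] F.TDivisor where
  toFun m := fun v => m v.1
  map_add' _ _ := rfl
  map_smul' _ _ := rfl

/-- The torus-invariant Cartier divisors: those which on each affine chart `U_σ`, `σ ∈ Σ`, agree
with the divisor of some character. -/
def cartier : Submodule ℤ F.TDivisor where
  carrier := {D | ∀ σ ∈ F.cones, ∃ m : Module.Dual ℤ (Fin n → ℤ),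
    ∀ v : F.rayGens, latticeVec v.1 ∈ σ → D v = m v.1}
  add_mem' := by
    intro D E hD hE σ hσ
    obtain ⟨m, hm⟩ := hD σ hσ
    obtain ⟨m', hm'⟩ := hE σ hσ
    exact ⟨m + m', fun v hv => by simp [hm v hv, hm' v hv]⟩
  zero_mem' := fun _ _ => ⟨0, fun _ _ => by simp⟩
  smul_mem' := by
    intro c D hD σ hσ
    obtain ⟨m, hm⟩ := hD σ hσ
    exact ⟨c • m, fun v hv => by simp [hm v hv]⟩

/-- The Picard group of `X_Σ` for a complete fan: torus-invariant Cartier divisors modulo divisors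
of characters. -/
abbrev Pic : Type := F.cartier ⧸ (LinearMap.range F.charDiv).submoduleOf F.cartier

/-- The Picard rank `ρ(X_Σ)`, the rank of the Picard group. -/
def picardRank : ℕ := Module.finrank ℤ F.Pic

/-- The anticanonical divisor `-K = ∑ D_v`. -/
def anticanonical : F.TDivisor := fun _ => 1

/-- Ampleness of a torus-invariant divisor `D = ∑ a_v D_v` on a complete toric variety: the
support function of `D` is strictly convex, that is, on each maximal cone `σ` it is given by some
`m_σ ∈ M` with `⟨m_σ, v⟩ = -a_v` for the `v ∈ G(Σ)` in `σ`, and `⟨m_σ, v⟩ > -a_v` for the other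
`v ∈ G(Σ)`. -/
def IsAmple (D : F.TDivisor) : Prop :=
  ∀ σ, Maximal (· ∈ F.cones) σ → ∃ m : Module.Dual ℤ (Fin n → ℤ), ∀ v : F.rayGens,
    (latticeVec v.1 ∈ σ → m v.1 = -D v) ∧ (latticeVec v.1 ∉ σ → -D v < m v.1)

/-- `X_Σ` is a smooth toric Fano variety: smooth and complete with ample anticanonical divisor. -/
structure IsSmoothFano : Prop where
  smooth : F.IsSmooth
  complete : F.IsComplete
  ample : F.IsAmple F.anticanonical

/-! ### Primitive collections and relations -/

/-- A primitive collection: a finite set of ray generators which do not together span a cone of the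
fan, while each of its proper subsets does. -/
structure IsPrimitiveCollection (P : Finset (Fin n → ℤ)) : Prop where
  subset_rayGens : (P : Set (Fin n → ℤ)) ⊆ F.rayGens
  not_cone : latticeCone (P : Set (Fin n → ℤ)) ∉ F.cones
  cone_of_ssubset : ∀ Q : Finset (Fin n → ℤ), Q ⊂ P →
    latticeCone (Q : Set (Fin n → ℤ)) ∈ F.cones

/-- The primitive relation `∑_{v ∈ P} v = ∑_y a_y y`: here `P` is a primitive collection, and the
`y` with `a_y > 0` are the generators of the minimal cone of the fan containing the left side. -/
structure IsPrimitiveRelation (P : Finset (Fin n → ℤ)) (a : (Fin n → ℤ) →₀ ℕ) : Prop where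
  primitive : F.IsPrimitiveCollection P
  support_subset : (a.support : Set (Fin n → ℤ)) ⊆ F.rayGens
  cone_mem : latticeCone (a.support : Set (Fin n → ℤ)) ∈ F.cones
  cone_minimal : ∀ τ ∈ F.cones, latticeVec (∑ v ∈ P, v) ∈ τ →
    latticeCone (a.support : Set (Fin n → ℤ)) ≤ τ
  sum_eq : ∑ v ∈ P, v = a.sum fun y c => c • y

end ToricFan

end

/-! The Picard rank of `X` is the number of ray generators minus `n`, so for a primitive collection
`P` with sum zero and `n + 1 - k` members it suffices to bound the number of generators outside `P`
by a function of `k`. Everything takes place on the lattice: a `FanoSystem` records the generators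
and the lattice bases (`facets`) of the full-dimensional cones, and `height` is the piecewise linear
function equal to `1` on the generators. The Fano condition says that `height` is strictly convex:
`basisDeg b x ≤ height x`, with equality exactly when the cone of `b` contains `x`. Call a generator
`w` incompatible with `x` if adding `w` to `x` does not raise the height of `x`.

The starting point is `exists_coneAt_neg_le_basisDeg`: some facet at `x` is bounded below on `y`, by
a constant depending only on the heights of `x` and `y` and not on the dimension. Two consequences
carry the argument.

* `exists_card_le`: the number of generators incompatible with `x` is bounded in terms of
  `height x`. Incompatible generators may be added to `x` all together without raising its height
  (`height_add_sum_le`), so at a facet at `x` where their sum is not very negative, all but boundedly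
  many of them have degree `0`, and each of those uses up some coordinate of `x`.
* `exists_bounded_combination`: for a positive combination of `r` generators there is another one,
  with coefficients bounded in terms of `r`, which lies in no other cones than the first; hence
  a generator incompatible with the first is incompatible with the second.

Let `L` be the lattice spanned by `P`. Since `P` has sum zero, `L` is covered by the cones over the
proper subsets of `P`. For `i ∈ P` the facets at `-i` contain `P` without `i`, so they have exactly
`k` members outside `P`. Two such facets provide a set `B` of at most `2k` generators which
generates the lattice modulo `L` and satisfies a positive relation modulo `L` (`exists_positive_relation`).
So for every generator `w` outside `P` there is a positive combination `x` of `B` with `x + w ∈ L`,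
and `w` is incompatible with `x`: otherwise `w` would be a generator of the minimal cone
containing `x + w`, but the generators of that cone belong to `P`. By the second
consequence each such `w` is incompatible with one of boundedly many points of bounded height, and
by the first each of these has boundedly many incompatible generators. -/

/-! ### Facets, degrees and the height function -/

/-- The combinatorial shadow of a smooth toric Fano variety on the lattice `ℤⁿ`: the set `gens` of
ray generators, and the set `facets` of lattice bases which generate the full-dimensional cones.
The cones cover the lattice, and `gens_facet` is the convexity of the Fano polytope: a generator
outside a facet lies strictly below the hyperplane through that facet. -/
structure FanoSystem (n : ℕ) where
  /-- The ray generators. -/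
  gens : Set (Fin n → ℤ)
  /-- The lattice bases generating the full-dimensional cones. -/
  facets : Set (Module.Basis (Fin n) ℤ (Fin n → ℤ))
  facet_gens : ∀ b ∈ facets, ∀ i, b i ∈ gens
  gens_facet : ∀ b ∈ facets, ∀ w ∈ gens, w ∈ Set.range b ∨ ∑ i, b.repr w i ≤ 0
  zero_notMem : 0 ∉ gens
  cover : ∀ x, ∃ b ∈ facets, ∀ i, 0 ≤ b.repr x i

/-- The linear form which takes the value `1` on each member of the basis `b`. -/
noncomputable def basisDeg {n : ℕ} (b : Module.Basis (Fin n) ℤ (Fin n → ℤ)) : (Fin n → ℤ) →ₗ[ℤ] ℤ :=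
  ∑ i, b.coord i

theorem basisDeg_apply {n : ℕ} (b : Module.Basis (Fin n) ℤ (Fin n → ℤ)) (x : Fin n → ℤ) :
    basisDeg b x = ∑ i, b.repr x i := by
  simp [basisDeg]

theorem basisDeg_self {n : ℕ} (b : Module.Basis (Fin n) ℤ (Fin n → ℤ)) (i : Fin n) :
    basisDeg b (b i) = 1 := by
  rw [basisDeg_apply, b.repr_self]
  simp [Finsupp.single_apply]

theorem repr_self_nonneg {n : ℕ} (b : Module.Basis (Fin n) ℤ (Fin n → ℤ)) (i j : Fin n) :
    0 ≤ b.repr (b i) j := by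
  rw [b.repr_self, Finsupp.single_apply]
  split_ifs <;> simp

theorem repr_le_basisDeg {n : ℕ} {b : Module.Basis (Fin n) ℤ (Fin n → ℤ)} {x : Fin n → ℤ}
    (h : ∀ i, 0 ≤ b.repr x i) (i : Fin n) : b.repr x i ≤ basisDeg b x := by
  rw [basisDeg_apply]
  exact Finset.single_le_sum (f := fun i => b.repr x i) (fun j _ => h j) (Finset.mem_univ i)

theorem basisDeg_nsmul {n : ℕ} (b : Module.Basis (Fin n) ℤ (Fin n → ℤ)) (c : ℕ) (x : Fin n → ℤ) :
    basisDeg b (c • x) = c * basisDeg b x := by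
  rw [map_nsmul]; exact nsmul_eq_mul _ _

theorem repr_nsmul {n : ℕ} (b : Module.Basis (Fin n) ℤ (Fin n → ℤ)) (c : ℕ) (x : Fin n → ℤ)
    (i : Fin n) : b.repr (c • x) i = c * b.repr x i := by
  rw [map_nsmul]; exact nsmul_eq_mul _ _

theorem repr_add_apply {n : ℕ} (b : Module.Basis (Fin n) ℤ (Fin n → ℤ)) (x y : Fin n → ℤ)
    (i : Fin n) : b.repr (x + y) i = b.repr x i + b.repr y i := by
  rw [map_add]; rfl

namespace FanoSystem

variable {n : ℕ} (S : FanoSystem n)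

/-- `b` generates a full-dimensional cone which contains `x`. -/
def ConeAt (b : Module.Basis (Fin n) ℤ (Fin n → ℤ)) (x : Fin n → ℤ) : Prop :=
  b ∈ S.facets ∧ ∀ i, 0 ≤ b.repr x i

/-- The piecewise linear function which is `1` on the ray generators, that is, the gauge of the
Fano polytope on lattice points. -/
noncomputable def height (x : Fin n → ℤ) : ℤ := basisDeg (S.cover x).choose x

variable {S} {b b' : Module.Basis (Fin n) ℤ (Fin n → ℤ)} {x y w : Fin n → ℤ}

theorem exists_coneAt (S : FanoSystem n) (x : Fin n → ℤ) : ∃ b, S.ConeAt b x := S.cover x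

theorem mem_range_or_basisDeg_nonpos (hb : b ∈ S.facets) (hw : w ∈ S.gens) :
    w ∈ Set.range b ∨ basisDeg b w ≤ 0 := by
  rw [basisDeg_apply]; exact S.gens_facet b hb w hw

theorem mem_range_of_basisDeg_pos (hb : b ∈ S.facets) (hw : w ∈ S.gens) (h : 1 ≤ basisDeg b w) :
    w ∈ Set.range b :=
  (mem_range_or_basisDeg_nonpos hb hw).resolve_right (by omega)

theorem basisDeg_eq_one (hw : w ∈ Set.range b) : basisDeg b w = 1 := by
  obtain ⟨i, rfl⟩ := hw; exact basisDeg_self b i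

theorem basisDeg_le_one (hb : b ∈ S.facets) (hw : w ∈ S.gens) : basisDeg b w ≤ 1 := by
  rcases mem_range_or_basisDeg_nonpos hb hw with h | h
  · exact (basisDeg_eq_one h).le
  · omega

theorem basisDeg_eq_sum (b' b : Module.Basis (Fin n) ℤ (Fin n → ℤ)) (x : Fin n → ℤ) :
    basisDeg b' x = ∑ i, b.repr x i * basisDeg b' (b i) := by
  conv_lhs => rw [← b.sum_repr x]
  simp only [map_sum, map_smul, smul_eq_mul]

theorem ConeAt.basisDeg_le (h : S.ConeAt b x) (hb' : b' ∈ S.facets) :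
    basisDeg b' x ≤ basisDeg b x := by
  rw [basisDeg_eq_sum b' b, basisDeg_apply b]
  refine Finset.sum_le_sum fun i _ => ?_
  nlinarith [h.2 i, basisDeg_le_one hb' (S.facet_gens b h.1 i)]

theorem ConeAt.height_eq (h : S.ConeAt b x) : basisDeg b x = S.height x :=
  le_antisymm (ConeAt.basisDeg_le (S.cover x).choose_spec h.1)
    (h.basisDeg_le (S.cover x).choose_spec.1)

theorem basisDeg_le_height (hb : b ∈ S.facets) (x : Fin n → ℤ) : basisDeg b x ≤ S.height x :=
  ConeAt.basisDeg_le (S.cover x).choose_spec hb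

/-- Strict convexity of the height: a facet computes the height only on its own cone. -/
theorem coneAt_of_height_le (hb : b ∈ S.facets) (h : S.height x ≤ basisDeg b x) :
    S.ConeAt b x := by
  obtain ⟨b₀, h₀⟩ := S.exists_coneAt x
  rw [← h₀.height_eq, basisDeg_eq_sum b b₀, basisDeg_apply b₀] at h
  have hterm : ∀ i ∈ Finset.univ, b₀.repr x i * basisDeg b (b₀ i) ≤ b₀.repr x i := fun i _ => by
    nlinarith [h₀.2 i, basisDeg_le_one hb (S.facet_gens b₀ h₀.1 i)]
  have heq := (Finset.sum_eq_sum_iff_of_le hterm).1 (le_antisymm (Finset.sum_le_sum hterm) h)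
  refine ⟨hb, fun j => ?_⟩
  rw [← b₀.sum_repr x]
  simp only [map_sum, map_smul, Finsupp.coe_finsetSum, Finset.sum_apply, Finsupp.smul_apply,
    smul_eq_mul]
  refine Finset.sum_nonneg fun i _ => ?_
  rcases (h₀.2 i).eq_or_lt with h0 | h0
  · simp [← h0]
  · have h1 : 1 ≤ basisDeg b (b₀ i) := by
      have := heq i (Finset.mem_univ i)
      nlinarith
    obtain ⟨l, hl⟩ := mem_range_of_basisDeg_pos hb (S.facet_gens b₀ h₀.1 i) h1
    rw [← hl]
    exact mul_nonneg h0.le (repr_self_nonneg b l j)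

theorem height_nonneg (S : FanoSystem n) (x : Fin n → ℤ) : 0 ≤ S.height x := by
  obtain ⟨b, hb⟩ := S.exists_coneAt x
  rw [← hb.height_eq, basisDeg_apply]
  exact Finset.sum_nonneg fun i _ => hb.2 i

theorem height_add_le (S : FanoSystem n) (x y : Fin n → ℤ) :
    S.height (x + y) ≤ S.height x + S.height y := by
  obtain ⟨b, hb⟩ := S.exists_coneAt (x + y)
  rw [← hb.height_eq, map_add]
  exact add_le_add (basisDeg_le_height hb.1 x) (basisDeg_le_height hb.1 y)

theorem height_zero (S : FanoSystem n) : S.height 0 = 0 := by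
  simp [height]

theorem height_sum_le {ι : Type*} (S : FanoSystem n) (s : Finset ι) (f : ι → Fin n → ℤ) :
    S.height (∑ i ∈ s, f i) ≤ ∑ i ∈ s, S.height (f i) :=
  Finset.le_sum_of_subadditive S.height S.height_zero.le S.height_add_le s f

theorem ConeAt.nsmul (h : S.ConeAt b x) (c : ℕ) : S.ConeAt b (c • x) :=
  ⟨h.1, fun i => by rw [repr_nsmul]; exact mul_nonneg (Int.natCast_nonneg c) (h.2 i)⟩

theorem height_nsmul (S : FanoSystem n) (c : ℕ) (x : Fin n → ℤ) :
    S.height (c • x) = c * S.height x := by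
  obtain ⟨b, hb⟩ := S.exists_coneAt x
  rw [← (hb.nsmul c).height_eq, ← hb.height_eq, basisDeg_nsmul]

theorem height_le_one (hw : w ∈ S.gens) : S.height w ≤ 1 := by
  obtain ⟨b, hb⟩ := S.exists_coneAt w
  rw [← hb.height_eq]
  exact basisDeg_le_one hb.1 hw

theorem ConeAt.left_of_add (h : S.ConeAt b (x + y))
    (hxy : S.height x + S.height y ≤ S.height (x + y)) : S.ConeAt b x := by
  refine coneAt_of_height_le h.1 ?_
  have := h.height_eq
  have := basisDeg_le_height h.1 y
  rw [map_add] at *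
  omega

theorem ConeAt.right_of_add (h : S.ConeAt b (x + y))
    (hxy : S.height x + S.height y ≤ S.height (x + y)) : S.ConeAt b y := by
  rw [add_comm] at h
  exact h.left_of_add (by rw [add_comm y x]; omega)

/-! ### Facets at a point which are bounded below on another point -/

/-- If the height of `z + x` falls short of additivity by at most `j`, then some facet at `x` is
bounded below on `z`. The induction on `j` moves `z` by `T • x`, where `T = height z + 1` exceeds
every coordinate of `z` in a cone containing it; this forces the defect to drop. -/
theorem exists_bound_of_defect (s j : ℕ) : ∀ h : ℕ, ∃ c : ℕ, ∀ (n : ℕ) (S : FanoSystem n)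
    (x z : Fin n → ℤ), S.height x ≤ s → S.height z ≤ h →
    S.height z + S.height x - j ≤ S.height (z + x) →
    ∃ b, S.ConeAt b x ∧ -(c : ℤ) ≤ basisDeg b z := by
  induction j with
  | zero =>
    refine fun h => ⟨0, fun n S x z _ _ hd => ?_⟩
    obtain ⟨b, hb⟩ := S.exists_coneAt (z + x)
    have hd' : S.height z + S.height x ≤ S.height (z + x) := by simpa using hd
    refine ⟨b, hb.right_of_add hd', ?_⟩
    rw [(hb.left_of_add hd').height_eq]
    simpa using S.height_nonneg z
  | succ j ih =>
    intro h
    obtain ⟨c₀, hc₀⟩ := ih h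
    obtain ⟨c₁, hc₁⟩ := ih (h + (h + 1) * s)
    refine ⟨max c₀ (c₁ + (h + 1) * s), fun n S x z hx hz hd => ?_⟩
    by_cases hj : S.height z + S.height x - j ≤ S.height (z + x)
    · obtain ⟨b, hb, hbz⟩ := hc₀ n S x z hx hz hj
      exact ⟨b, hb, le_trans (by push_cast; omega) hbz⟩
    push_cast at hd
    obtain ⟨T, hT⟩ := Int.eq_ofNat_of_zero_le (add_nonneg (S.height_nonneg z) zero_le_one)
    have hTh : (T : ℤ) ≤ h + 1 := by omega
    have hxs : (T : ℤ) * S.height x ≤ (h + 1) * s :=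
      mul_le_mul hTh hx (S.height_nonneg x) (by positivity)
    have hz' : S.height (z + T • x) ≤ S.height z + T * S.height x := by
      rw [← S.height_nsmul]; exact S.height_add_le _ _
    -- Otherwise a facet at `z + T • x` has degree below `height x` at `x`, hence a negative
    -- coordinate there, while it still contains `z`; but `z` has no coordinate as large as `T`.
    have key : S.height (z + T • x) + S.height x - j ≤ S.height (z + T • x + x) := by
      by_contra hcon
      obtain ⟨b, hb⟩ := S.exists_coneAt (z + T • x)
      obtain ⟨b₀, hb₀⟩ := S.exists_coneAt (z + x)
      have e1 := hb.height_eq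
      have e2 := basisDeg_le_height hb.1 (z + T • x + x)
      have e3 := hb₀.height_eq
      have e4 := basisDeg_le_height hb₀.1 z
      have e5 := basisDeg_le_height hb₀.1 (z + T • x)
      have e6 := basisDeg_le_height hb.1 z
      simp only [map_add, basisDeg_nsmul] at e1 e2 e3 e5
      have hσ : basisDeg b x ≤ S.height (z + x) - S.height z := by omega
      have hσ₀ : S.height (z + x) - S.height z ≤ basisDeg b₀ x := by omega
      have hzc : S.ConeAt b z := by
        refine coneAt_of_height_le hb.1 ?_
        have hT0 : (0 : ℤ) ≤ T := by omega
        have h1 := mul_le_mul_of_nonneg_left hσ hT0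
        have h2 := mul_le_mul_of_nonneg_left hσ₀ hT0
        have h3 : S.height z + T * (S.height (z + x) - S.height z) ≤ S.height (z + T • x) := by
          have hT1 : (0 : ℤ) ≤ T - 1 := by linarith [S.height_nonneg z]
          nlinarith [mul_le_mul_of_nonneg_left hσ₀ hT1]
        omega
      have hxc : ¬ S.ConeAt b x := fun hx' => by
        have := hx'.height_eq
        omega
      have : ∃ i, b.repr x i < 0 := by
        by_contra hcon'
        push Not at hcon'
        exact hxc ⟨hb.1, hcon'⟩
      obtain ⟨i, hi⟩ := this
      have f1 := hb.2 i
      rw [repr_add_apply, repr_nsmul] at f1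
      have hT0 : (0 : ℤ) ≤ T := by positivity
      have f2 := repr_le_basisDeg hzc.2 i
      nlinarith
    obtain ⟨b, hb, hbz⟩ := hc₁ n S x (z + T • x) hx (by push_cast; omega) key
    refine ⟨b, hb, ?_⟩
    rw [map_add, map_nsmul, nsmul_eq_mul, hb.height_eq] at hbz
    push_cast
    have : -((c₁ : ℤ) + (h + 1) * s) ≤ basisDeg b z := by omega
    exact le_trans (neg_le_neg (le_max_right _ _)) this

end FanoSystem

namespace FanoSystem

variable {n : ℕ} {S : FanoSystem n} {b b' : Module.Basis (Fin n) ℤ (Fin n → ℤ)}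
  {x y w : Fin n → ℤ}

/-- Among the facets at `x` there is one on which `y` is not very negative, with a bound in terms
of the heights only. -/
theorem exists_coneAt_neg_le_basisDeg (s h : ℕ) : ∃ c : ℕ, ∀ (n : ℕ) (S : FanoSystem n)
    (x y : Fin n → ℤ), S.height x ≤ s → S.height y ≤ h →
    ∃ b, S.ConeAt b x ∧ -(c : ℤ) ≤ basisDeg b y := by
  obtain ⟨c, hc⟩ := exists_bound_of_defect s (s + h) h
  refine ⟨c, fun n S x y hx hy => hc n S x y hx hy ?_⟩
  have := S.height_nonneg (y + x)
  push_cast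
  omega

/-! ### Generators which do not raise the height of a point -/

/-- If adding any single member of a set of generators does not raise the height of `x`, then
adding all of them does not raise it either. -/
theorem height_add_sum_le (W : Finset (Fin n → ℤ))
    (hW : ∀ w ∈ W, w ∈ S.gens ∧ S.height (x + w) ≤ S.height x) :
    S.height (x + ∑ w ∈ W, w) ≤ S.height x := by
  induction W using Finset.strongInduction with
  | H W ih =>
    by_contra hcon
    push Not at hcon
    obtain ⟨b, hb⟩ := S.exists_coneAt (x + ∑ w ∈ W, w)
    have herase : ∀ w ∈ W, S.height (x + ∑ v ∈ W.erase w, v) ≤ S.height x := fun w hw =>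
      ih _ (Finset.erase_ssubset hw) fun v hv => hW v (Finset.mem_of_mem_erase hv)
    have hsplit : ∀ w ∈ W, basisDeg b (x + ∑ v ∈ W, v) =
        basisDeg b (x + ∑ v ∈ W.erase w, v) + basisDeg b w := fun w hw => by
      rw [← map_add, add_assoc, Finset.sum_erase_add _ _ hw]
    have hrange : ∀ w ∈ W, w ∈ Set.range b := fun w hw => by
      refine mem_range_of_basisDeg_pos hb.1 (hW w hw).1 ?_
      have := hsplit w hw
      have := herase w hw
      have := basisDeg_le_height (S := S) hb.1 (x + ∑ v ∈ W.erase w, v)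
      have := hb.height_eq
      omega
    have hcone : ∀ w ∈ W, S.ConeAt b (x + ∑ v ∈ W.erase w, v) := fun w hw => by
      refine coneAt_of_height_le hb.1 ?_
      have := hsplit w hw
      have := herase w hw
      have := basisDeg_eq_one (hrange w hw)
      have := hb.height_eq
      omega
    have hne : W.Nonempty := by
      rw [Finset.nonempty_iff_ne_empty]
      rintro rfl
      simp at hcon
    -- For each coordinate, the members of `W` other than a suitable one do not contribute to it.
    have hx : S.ConeAt b x := by
      refine ⟨hb.1, fun i => ?_⟩
      obtain ⟨w, hw, hi⟩ : ∃ w ∈ W, ∀ v ∈ W.erase w, b.repr v i = 0 := by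
        by_cases hbi : b i ∈ W
        · refine ⟨b i, hbi, fun v hv => ?_⟩
          obtain ⟨l, rfl⟩ := hrange v (Finset.mem_of_mem_erase hv)
          rw [b.repr_self, Finsupp.single_eq_of_ne]
          rintro rfl
          simp at hv
        · obtain ⟨w, hw⟩ := hne
          refine ⟨w, hw, fun v hv => ?_⟩
          have hv' := Finset.mem_of_mem_erase hv
          obtain ⟨l, rfl⟩ := hrange v hv'
          rw [b.repr_self, Finsupp.single_eq_of_ne]
          rintro rfl
          exact hbi hv'
      have := (hcone w hw).2 i
      rw [repr_add_apply, map_sum, Finsupp.finsetSum_apply, Finset.sum_eq_zero hi] at this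
      simpa using this
    have hcard : basisDeg b (x + ∑ v ∈ W, v) = basisDeg b x + W.card := by
      rw [map_add, map_sum, Finset.sum_congr rfl fun w hw => basisDeg_eq_one (hrange w hw)]
      simp
    obtain ⟨w, hw⟩ := hne
    have h1 := hsplit w hw
    have h2 := (hcone w hw).height_eq
    have h3 := herase w hw
    have h4 := basisDeg_eq_one (hrange w hw)
    have h5 := hx.height_eq
    have h6 : W.card = 1 := by
      have : 1 ≤ W.card := Finset.card_pos.2 ⟨w, hw⟩
      omega
    obtain ⟨v, rfl⟩ := Finset.card_eq_one.1 h6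
    have := (hW v (Finset.mem_singleton_self v)).2
    simp only [Finset.sum_singleton] at hcon
    omega

/-- The number of generators whose addition does not raise the height of `x` is bounded in terms of
that height. At a facet where their sum is not very negative, few of them are below level `0`, and
those on level `0` are counted by their negative coordinates. -/
theorem exists_card_le (r : ℕ) : ∃ C : ℕ, ∀ (n : ℕ) (S : FanoSystem n) (x : Fin n → ℤ),
    S.height x ≤ r → ∀ W : Finset (Fin n → ℤ),
    (∀ w ∈ W, w ∈ S.gens ∧ S.height (x + w) ≤ S.height x) → W.card ≤ C := by
  obtain ⟨c, hc⟩ := exists_coneAt_neg_le_basisDeg r r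
  refine ⟨c + 2 * r, fun n S x hx W hW => ?_⟩
  obtain ⟨b, hb, hbW⟩ := hc n S x (x + ∑ w ∈ W, w) hx ((height_add_sum_le W hW).trans hx)
  have hxb := hb.height_eq
  have hle : ∀ w ∈ W, basisDeg b w ≤ 0 := fun w hw => by
    by_contra hcon
    have h1 := basisDeg_le_height (S := S) hb.1 (x + w)
    rw [map_add] at h1
    have := (hW w hw).2
    omega
  rw [map_add, map_sum] at hbW
  set N := W.filter fun w => basisDeg b w < 0 with hN
  set Z := W.filter fun w => ¬ basisDeg b w < 0 with hZ
  have hcardN : N.card ≤ c + r := by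
    have h1 : ∑ w ∈ W, basisDeg b w ≤ ∑ w ∈ W, if basisDeg b w < 0 then (-1 : ℤ) else 0 := by
      refine Finset.sum_le_sum fun w hw => ?_
      have := hle w hw
      split_ifs <;> omega
    rw [← Finset.sum_filter, Finset.sum_const, ← hN] at h1
    simp only [nsmul_eq_mul] at h1
    omega
  have hZdeg : ∀ w ∈ Z, basisDeg b w = 0 := fun w hw => by
    have h1 := Finset.mem_filter.1 hw
    have h2 := hle w h1.1
    omega
  have hcoord : ∀ i, (((Z.filter fun w => b.repr w i < 0).card : ℕ) : ℤ) ≤ b.repr x i := by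
    intro i
    set B := Z.filter fun w => b.repr w i < 0 with hB
    have hBZ : B ⊆ Z := Finset.filter_subset _ _
    have hBW : B ⊆ W := hBZ.trans (Finset.filter_subset _ _)
    have h1 : S.ConeAt b (x + ∑ w ∈ B, w) := by
      refine coneAt_of_height_le hb.1 ?_
      rw [map_add, map_sum, Finset.sum_eq_zero fun w hw => hZdeg w (hBZ hw), add_zero, hxb]
      exact height_add_sum_le B fun w hw => hW w (hBW hw)
    have h2 := h1.2 i
    rw [repr_add_apply, map_sum, Finsupp.finsetSum_apply] at h2
    have h3 : ∑ w ∈ B, b.repr w i ≤ ∑ w ∈ B, (-1 : ℤ) := Finset.sum_le_sum fun w hw => by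
      have := (Finset.mem_filter.1 hw).2
      omega
    simp only [Finset.sum_const, nsmul_eq_mul] at h3
    omega
  have hcover : Z ⊆ Finset.univ.biUnion fun i => Z.filter fun w => b.repr w i < 0 := by
    intro w hw
    simp only [Finset.mem_biUnion, Finset.mem_univ, true_and, Finset.mem_filter]
    by_contra hcon
    push Not at hcon
    have hnn : ∀ i, 0 ≤ b.repr w i := fun i => hcon i hw
    have hz := hZdeg w hw
    rw [basisDeg_apply, Finset.sum_eq_zero_iff_of_nonneg fun i _ => hnn i] at hz
    have hw0 : w = 0 := b.ext_elem fun i => by simpa using hz i (Finset.mem_univ i)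
    exact S.zero_notMem (hw0 ▸ (hW w (Finset.mem_filter.1 hw).1).1)
  have hcardZ : Z.card ≤ r := by
    have h1 := (Finset.card_le_card hcover).trans Finset.card_biUnion_le
    have h2 := Finset.sum_le_sum fun i (_ : i ∈ Finset.univ) => hcoord i
    rw [← basisDeg_apply, hxb, ← Nat.cast_sum] at h2
    omega
  have : N.card + Z.card = W.card := Finset.card_filter_add_card_filter_not _
  omega

end FanoSystem

/-! ### Positive combinations with bounded coefficients -/

/-- A map to a finite type has representatives of its fibres of bounded size. -/
theorem exists_bounded_representatives {α β : Type*} [Finite β] (f : α → β) (size : α → ℕ) :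
    ∃ M : ℕ, ∀ a, ∃ a', f a' = f a ∧ size a' ≤ M := by
  classical
  have hg : ∀ y : Set.range f, ∃ a, f a = y := fun y => y.2
  choose g hg using hg
  obtain ⟨M, hM⟩ := (Set.finite_range fun y => size (g y)).bddAbove
  exact ⟨M, fun a => ⟨g ⟨f a, a, rfl⟩, hg _, hM ⟨_, rfl⟩⟩⟩

namespace FanoSystem

variable {n : ℕ} {S : FanoSystem n} {b b' : Module.Basis (Fin n) ℤ (Fin n → ℤ)}
  {x y w : Fin n → ℤ}

theorem basisDeg_sum_nsmul {r : ℕ} (b : Module.Basis (Fin n) ℤ (Fin n → ℤ)) (a : Fin r → ℕ)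
    (g : Fin r → Fin n → ℤ) :
    basisDeg b (∑ i, a i • g i) = ∑ i, basisDeg b (g i) * a i := by
  rw [map_sum]
  exact Finset.sum_congr rfl fun i _ => by rw [basisDeg_nsmul, mul_comm]

/-- A positive combination of `r` generators lies in no more cones than some positive combination
of them with coefficients bounded in terms of `r` alone. By induction on `r`, the values on the
generators of a facet at such a combination lie in a fixed finite box, so that only the ordering
which the coefficient vector induces on the box matters. -/
theorem exists_bounded_combination (r : ℕ) : ∃ M : ℕ, ∀ (n : ℕ) (S : FanoSystem n)
    (g : Fin r → Fin n → ℤ), (∀ i, g i ∈ S.gens) → ∀ a : Fin r → ℕ, (∀ i, 1 ≤ a i) →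
    ∃ m : Fin r → ℕ, (∀ i, 1 ≤ m i ∧ m i ≤ M) ∧
      ∀ b, S.ConeAt b (∑ i, m i • g i) → S.ConeAt b (∑ i, a i • g i) := by
  induction r with
  | zero => exact ⟨0, fun n S g _ a _ => ⟨a, fun i => i.elim0, fun b hb => by simpa using hb⟩⟩
  | succ r ih =>
    obtain ⟨M, hM⟩ := ih
    obtain ⟨c, hc⟩ := exists_coneAt_neg_le_basisDeg (r * M) 1
    have hbox : ∀ (n : ℕ) (S : FanoSystem n) (g : Fin (r + 1) → Fin n → ℤ),
        (∀ i, g i ∈ S.gens) → ∀ a : Fin (r + 1) → ℕ, (∀ i, 1 ≤ a i) →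
        ∀ b, S.ConeAt b (∑ i, a i • g i) →
        (fun i => basisDeg b (g i)) ∈ Finset.Icc (fun _ : Fin (r + 1) => -(c : ℤ)) fun _ => 1 := by
      intro n S g hg a ha b hb
      refine Finset.mem_Icc.2 ⟨fun i => ?_, fun i => basisDeg_le_one hb.1 (hg i)⟩
      obtain ⟨m, hm, hmb⟩ := hM n S (fun j => g (i.succAbove j)) (fun j => hg _)
        (fun j => a (i.succAbove j)) (fun j => ha _)
      have hheight : S.height (∑ j, m j • g (i.succAbove j)) ≤ (r * M : ℕ) := by
        refine (S.height_sum_le _ _).trans ?_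
        refine (Finset.sum_le_card_nsmul _ _ (M : ℤ) fun j _ => ?_).trans ?_
        · rw [S.height_nsmul]
          have h1 := height_le_one (hg (i.succAbove j))
          have h2 : ((m j : ℕ) : ℤ) ≤ M := by exact_mod_cast (hm j).2
          nlinarith
        · simp
      obtain ⟨b₁, hb₁, hb₁i⟩ := hc n S _ (g i) hheight (by simpa using height_le_one (hg i))
      have h1 := (hmb b₁ hb₁).basisDeg_le hb.1
      have h2 := hb.basisDeg_le (hmb b₁ hb₁).1
      rw [Fin.sum_univ_succAbove _ i, map_add, map_add, basisDeg_nsmul, basisDeg_nsmul] at h2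
      have h3 : (a i : ℤ) * basisDeg b₁ (g i) ≤ a i * basisDeg b (g i) := by linarith
      have h4 : (0 : ℤ) < a i := by exact_mod_cast ha i
      exact hb₁i.trans (le_of_mul_le_mul_left h3 h4)
    set K := Finset.Icc (fun _ : Fin (r + 1) => -(c : ℤ)) fun _ => 1 with hK
    obtain ⟨M', hM'⟩ := exists_bounded_representatives
      (fun a : {a : Fin (r + 1) → ℕ // ∀ i, 1 ≤ a i} =>
        {p : K × K | ∑ i, p.2.1 i * (a.1 i : ℤ) ≤ ∑ i, p.1.1 i * (a.1 i : ℤ)})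
      (fun a => ∑ i, a.1 i)
    refine ⟨M', fun n S g hg a ha => ?_⟩
    obtain ⟨⟨m, hm⟩, hpat, hsize⟩ := hM' ⟨a, ha⟩
    refine ⟨m, fun i => ⟨hm i, (Finset.single_le_sum (f := m) (fun _ _ => Nat.zero_le _)
      (Finset.mem_univ i)).trans hsize⟩, fun b hb => ?_⟩
    obtain ⟨b₁, hb₁⟩ := S.exists_coneAt (∑ i, a i • g i)
    have h1 := hb.basisDeg_le hb₁.1
    rw [basisDeg_sum_nsmul, basisDeg_sum_nsmul] at h1
    have h2 : ((⟨_, hbox n S g hg m hm b hb⟩, ⟨_, hbox n S g hg a ha b₁ hb₁⟩) : K × K) ∈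
        {p : K × K | ∑ i, p.2.1 i * (m i : ℤ) ≤ ∑ i, p.1.1 i * (m i : ℤ)} := h1
    rw [hpat] at h2
    refine coneAt_of_height_le hb.1 ?_
    rw [← hb₁.height_eq, basisDeg_sum_nsmul, basisDeg_sum_nsmul]
    exact h2

end FanoSystem

/-! ### Generators outside a zero-sum collection -/

namespace FanoSystem

variable {n k : ℕ} {S : FanoSystem n} {b b' : Module.Basis (Fin n) ℤ (Fin n → ℤ)}
  {x y w : Fin n → ℤ} {P : Finset (Fin n → ℤ)}

/-- A finite set of generators with sum zero such that all its members but any given one belong to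
a common facet. -/
structure IsCentralCollection (S : FanoSystem n) (P : Finset (Fin n → ℤ)) : Prop where
  nonempty : P.Nonempty
  subset_gens : ∀ v ∈ P, v ∈ S.gens
  sum_eq_zero : ∑ v ∈ P, v = 0
  exists_facet : ∀ i ∈ P, ∃ b ∈ S.facets, ∀ v ∈ P.erase i, v ∈ Set.range b

theorem coneAt_sum_of_mem_range (hb : b ∈ S.facets) (Q : Finset (Fin n → ℤ))
    (t : (Fin n → ℤ) → ℕ) (h : ∀ v ∈ Q, v ∈ Set.range b) : S.ConeAt b (∑ v ∈ Q, t v • v) := by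
  refine ⟨hb, fun j => ?_⟩
  rw [map_sum, Finsupp.finsetSum_apply]
  refine Finset.sum_nonneg fun v hv => ?_
  obtain ⟨l, rfl⟩ := h v hv
  rw [repr_nsmul]
  exact mul_nonneg (Int.natCast_nonneg _) (repr_self_nonneg b l j)

/-- Every facet at a nonnegative combination of generators of one facet contains the generators
which occur in it. -/
theorem ConeAt.mem_range_of_sum (hb : b ∈ S.facets) {Q : Finset (Fin n → ℤ)}
    (t : (Fin n → ℤ) → ℕ) (h : ∀ v ∈ Q, v ∈ Set.range b) (hg : ∀ v ∈ Q, v ∈ S.gens)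
    (hb' : S.ConeAt b' (∑ v ∈ Q, t v • v)) {v : Fin n → ℤ} (hv : v ∈ Q) (htv : t v ≠ 0) :
    v ∈ Set.range b' := by
  have h1 := (coneAt_sum_of_mem_range hb Q t h).basisDeg_le hb'.1
  have h2 := hb'.basisDeg_le hb
  have h3 := le_antisymm h1 h2
  rw [map_sum, map_sum] at h3
  have hterm : ∀ v ∈ Q, basisDeg b' (t v • v) ≤ basisDeg b (t v • v) := fun v hv => by
    rw [basisDeg_nsmul, basisDeg_nsmul, basisDeg_eq_one (h v hv)]
    nlinarith [basisDeg_le_one hb'.1 (hg v hv)]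
  have h4 := (Finset.sum_eq_sum_iff_of_le hterm).1 h3 v hv
  rw [basisDeg_nsmul, basisDeg_nsmul, basisDeg_eq_one (h v hv)] at h4
  have h5 : (t v : ℤ) ≠ 0 := by exact_mod_cast htv
  exact mem_range_of_basisDeg_pos hb'.1 (hg v hv) (mul_left_cancel₀ h5 h4).ge

/-- Some facet at `x` contains `y` after a translation of `y` by a large multiple of `x`. -/
theorem exists_coneAt_add_nsmul (S : FanoSystem n) (x y : Fin n → ℤ) :
    ∃ (N : ℕ) (b : _), S.ConeAt b x ∧ S.ConeAt b (y + N • x) := by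
  obtain ⟨N, hN⟩ := Int.eq_ofNat_of_zero_le
    (add_nonneg (add_nonneg (S.height_nonneg y) (S.height_nonneg (-y))) zero_le_one)
  obtain ⟨b, hb⟩ := S.exists_coneAt (y + N • x)
  refine ⟨N, b, coneAt_of_height_le hb.1 ?_, hb⟩
  by_contra hcon
  have h1 := hb.height_eq
  have h2 := S.height_add_le (y + N • x) (-y)
  rw [add_neg_cancel_comm, S.height_nsmul, ← h1, map_add, basisDeg_nsmul] at h2
  have h3 := basisDeg_le_height (S := S) hb.1 y
  have h4 := S.height_nonneg y
  have h5 := S.height_nonneg (-y)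
  nlinarith

namespace IsCentralCollection

variable (hP : S.IsCentralCollection P)
include hP

/-- Every point of the lattice spanned by a zero-sum set is a nonnegative combination of all its
members but one: shift the coefficients by their minimum. -/
theorem exists_nonneg_combination (hx : x ∈ Submodule.span ℤ (P : Set (Fin n → ℤ))) :
    ∃ i ∈ P, ∃ t : (Fin n → ℤ) → ℕ, x = ∑ v ∈ P.erase i, t v • v := by
  obtain ⟨f, -, rfl⟩ := Submodule.mem_span_finset.1 hx
  obtain ⟨i, hi, hmin⟩ := P.exists_min_image f hP.nonempty
  refine ⟨i, hi, fun v => (f v - f i).toNat, ?_⟩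
  have h1 : ∑ v ∈ P, f v • v = ∑ v ∈ P, (f v - f i) • v := by
    simp only [sub_smul, Finset.sum_sub_distrib]
    rw [← Finset.smul_sum, hP.sum_eq_zero, smul_zero, sub_zero]
  rw [h1, ← Finset.sum_erase P (a := i) (by simp)]
  refine Finset.sum_congr rfl fun v hv => ?_
  have h2 : 0 ≤ f v - f i := sub_nonneg.2 (hmin v (Finset.mem_of_mem_erase hv))
  rw [← natCast_zsmul, Int.toNat_of_nonneg h2]

/-- A cone containing a point of the lattice spanned by `P` has only members of `P` as generators of
its smallest face through this point. -/
theorem mem_of_repr_ne_zero (hx : x ∈ Submodule.span ℤ (P : Set (Fin n → ℤ)))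
    (hb : S.ConeAt b x) {j : Fin n} (hj : b.repr x j ≠ 0) : b j ∈ P := by
  obtain ⟨i, hi, t, rfl⟩ := hP.exists_nonneg_combination hx
  obtain ⟨b₀, hb₀, hr⟩ := hP.exists_facet i hi
  rw [map_sum, Finsupp.finsetSum_apply] at hj
  obtain ⟨v, hv, hvj⟩ := Finset.exists_ne_zero_of_sum_ne_zero hj
  rw [repr_nsmul] at hvj
  have htv : t v ≠ 0 := fun h => hvj (by simp [h])
  obtain ⟨l, rfl⟩ := ConeAt.mem_range_of_sum hb₀ t hr
    (fun v hv => hP.subset_gens v (Finset.mem_of_mem_erase hv)) hb hv htv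
  rw [b.repr_self] at hvj
  have : l = j := by
    by_contra hlj
    rw [Finsupp.single_eq_of_ne (Ne.symm hlj)] at hvj
    simp at hvj
  exact this ▸ Finset.mem_of_mem_erase hv

theorem neg_eq_sum_erase {i : Fin n → ℤ} (hi : i ∈ P) : -i = ∑ v ∈ P.erase i, v := by
  rw [neg_eq_iff_add_eq_zero, Finset.add_sum_erase P (fun v => v) hi, hP.sum_eq_zero]

/-- A facet at `-i`, where `i ∈ P`, contains the members of `P` other than `i`. -/
theorem mem_range_of_coneAt_neg {i : Fin n → ℤ} (hi : i ∈ P) (hb : S.ConeAt b (-i)) :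
    ∀ v ∈ P.erase i, v ∈ Set.range b := by
  obtain ⟨b₀, hb₀, hr⟩ := hP.exists_facet i hi
  intro v hv
  refine ConeAt.mem_range_of_sum hb₀ (fun _ => 1) hr
    (fun v hv => hP.subset_gens v (Finset.mem_of_mem_erase hv)) ?_ hv one_ne_zero
  simpa only [one_smul, ← hP.neg_eq_sum_erase hi] using hb

/-- A facet at `-i`, where `i ∈ P`, has exactly `k` members outside `P`. -/
theorem card_image_sdiff (hcard : P.card + k = n + 1) {i : Fin n → ℤ} (hi : i ∈ P)
    (hb : S.ConeAt b (-i)) : (Finset.univ.image b \ P).card = k := by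
  have hr := hP.mem_range_of_coneAt_neg hi hb
  have hib : i ∉ Set.range b := fun h => by
    have h1 := hb.height_eq
    rw [map_neg, basisDeg_eq_one h] at h1
    have := S.height_nonneg (-i)
    omega
  have hinter : P ∩ Finset.univ.image b = P.erase i := by
    ext v
    simp only [Finset.mem_inter, Finset.mem_image, Finset.mem_univ, true_and, Finset.mem_erase]
    constructor
    · rintro ⟨hv, hvb⟩
      exact ⟨fun h => hib (h ▸ hvb), hv⟩
    · rintro ⟨hv, hvP⟩
      exact ⟨hvP, hr v (Finset.mem_erase.2 ⟨hv, hvP⟩)⟩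
  rw [Finset.card_sdiff, hinter, Finset.card_erase_of_mem hi,
    Finset.card_image_of_injective _ b.injective, Finset.card_univ, Fintype.card_fin]
  have := Finset.card_pos.2 hP.nonempty
  omega

/-- A set of at most `2k` generators which generates the lattice modulo the span of `P`, together
with a relation with positive coefficients between them modulo that span. -/
theorem exists_positive_relation (hcard : P.card + k = n + 1) :
    ∃ (B : Finset (Fin n → ℤ)) (β : (Fin n → ℤ) → ℤ), (∀ v ∈ B, v ∈ S.gens) ∧ B.card ≤ 2 * k ∧
      (∀ v ∈ B, 1 ≤ β v) ∧ ∑ v ∈ B, β v • v ∈ Submodule.span ℤ (P : Set (Fin n → ℤ)) ∧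
      ∀ w, ∃ c : (Fin n → ℤ) → ℤ,
        w - ∑ v ∈ B, c v • v ∈ Submodule.span ℤ (P : Set (Fin n → ℤ)) := by
  set L := Submodule.span ℤ (P : Set (Fin n → ℤ)) with hL
  obtain ⟨i, hi⟩ := hP.nonempty
  obtain ⟨b₁, hb₁⟩ := S.exists_coneAt (-i)
  set U := Finset.univ.image b₁ \ P with hU
  obtain ⟨N, b₂, hb₂, hb₂y⟩ := S.exists_coneAt_add_nsmul (-i) (-∑ u ∈ U, u)
  set y := -(∑ u ∈ U, u) + N • (-i) with hy
  -- The positive relation is `∑ u ∈ U, u + y = N • (-i)`, where `y` is expanded in the facet `b₂`;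
  -- `J` indexes the terms of the expansion which are nonzero modulo the span of `P`.
  set J := Finset.univ.filter fun l => b₂ l ∉ P ∧ b₂.repr y l ≠ 0 with hJ
  set U₂ := J.image b₂ with hU₂
  have hU₂sub : U₂ ⊆ Finset.univ.image b₂ \ P := by
    intro v hv
    obtain ⟨l, hl, rfl⟩ := Finset.mem_image.1 hv
    exact Finset.mem_sdiff.2 ⟨Finset.mem_image_of_mem _ (Finset.mem_univ l),
      (Finset.mem_filter.1 hl).2.1⟩
  set γ : (Fin n → ℤ) → ℤ := Function.extend b₂ (b₂.repr y) 0 with hγ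
  have hγb : ∀ l, γ (b₂ l) = b₂.repr y l := fun l => b₂.injective.extend_apply _ _ l
  have hPL : ∀ v ∈ P, v ∈ L := fun v hv => Submodule.subset_span hv
  have hU₂L : y - ∑ v ∈ U₂, γ v • v ∈ L := by
    rw [hU₂, Finset.sum_image fun _ _ _ _ h => b₂.injective h]
    simp only [hγb]
    nth_rewrite 1 [← b₂.sum_repr y]
    rw [← Finset.sum_sdiff (Finset.subset_univ J), add_sub_cancel_right]
    refine Submodule.sum_mem _ fun l hl => ?_
    by_cases hlP : b₂ l ∈ P
    · exact Submodule.smul_mem _ _ (hPL _ hlP)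
    · have : b₂.repr y l = 0 := by
        by_contra h
        exact (Finset.mem_sdiff.1 hl).2 (Finset.mem_filter.2 ⟨Finset.mem_univ l, hlP, h⟩)
      rw [this, zero_smul]
      exact Submodule.zero_mem _
  refine ⟨U ∪ U₂, fun v => (if v ∈ U then 1 else 0) + if v ∈ U₂ then γ v else 0, ?_, ?_, ?_, ?_, ?_⟩
  · intro v hv
    rcases Finset.mem_union.1 hv with hv | hv
    · obtain ⟨l, -, rfl⟩ := Finset.mem_image.1 (Finset.mem_sdiff.1 hv).1
      exact S.facet_gens b₁ hb₁.1 l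
    · obtain ⟨l, -, rfl⟩ := Finset.mem_image.1 hv
      exact S.facet_gens b₂ hb₂.1 l
  · have h1 := hP.card_image_sdiff hcard hi hb₁
    have h2 := hP.card_image_sdiff hcard hi hb₂
    have h3 := Finset.card_le_card hU₂sub
    have h4 := Finset.card_union_le U U₂
    linarith
  · intro v hv
    have hγpos : v ∈ U₂ → 1 ≤ γ v := fun h => by
      obtain ⟨l, hl, rfl⟩ := Finset.mem_image.1 h
      rw [hγb]
      have h1 := hb₂y.2 l
      have h2 := (Finset.mem_filter.1 hl).2.2
      omega
    rcases Finset.mem_union.1 hv with hv | hv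
    · simp only [hv, if_true]
      split_ifs with h
      · linarith [hγpos h]
      · simp
    · simp only [hv, if_true]
      split_ifs with h
      · linarith [hγpos hv]
      · linarith [hγpos hv]
  · simp only [add_smul, Finset.sum_add_distrib, ite_smul, one_smul, zero_smul, Finset.sum_ite_mem,
      Finset.union_inter_cancel_left, Finset.union_inter_cancel_right]
    have h1 : ∑ v ∈ U, v + ∑ v ∈ U₂, γ v • v = N • (-i) - (y - ∑ v ∈ U₂, γ v • v) := by
      rw [hy]; abel
    rw [h1]
    exact L.sub_mem (L.nsmul_mem (L.neg_mem (hPL i hi)) N) hU₂L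
  · intro w
    have htop : w ∈ Submodule.span ℤ (U : Set (Fin n → ℤ)) ⊔ L := by
      have : (⊤ : Submodule ℤ (Fin n → ℤ)) ≤ Submodule.span ℤ (U : Set (Fin n → ℤ)) ⊔ L := by
        rw [← b₁.span_eq, Submodule.span_le]
        rintro _ ⟨l, rfl⟩
        by_cases hl : b₁ l ∈ P
        · exact Submodule.mem_sup_right (hPL _ hl)
        · exact Submodule.mem_sup_left (Submodule.subset_span (Finset.mem_coe.2
            (Finset.mem_sdiff.2 ⟨Finset.mem_image_of_mem _ (Finset.mem_univ l), hl⟩)))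
      exact this trivial
    obtain ⟨u, hu, l, hl, rfl⟩ := Submodule.mem_sup.1 htop
    obtain ⟨c, hc, rfl⟩ := Submodule.mem_span_finset.1 hu
    refine ⟨c, ?_⟩
    have h1 : ∑ v ∈ U ∪ U₂, c v • v = ∑ v ∈ U, c v • v := by
      refine (Finset.sum_subset Finset.subset_union_left fun v _ hv => ?_).symm
      rw [Function.notMem_support.1 fun h => hv (hc h), zero_smul]
    rw [h1, add_sub_cancel_left]
    exact hl

/-- There are at most `2k` generators such that each generator outside `P` fails to raise the
height of some positive combination `x` of them. Here `x` is chosen with `x + w` in the lattice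
spanned by `P`, so that `w ∉ P` cannot generate an edge of the minimal cone at `x + w`. -/
theorem exists_incompatible_combination (hcard : P.card + k = n + 1) :
    ∃ B : Finset (Fin n → ℤ), (∀ v ∈ B, v ∈ S.gens) ∧ B.card ≤ 2 * k ∧
      ∀ w ∈ S.gens, w ∉ P → ∃ a : (Fin n → ℤ) → ℕ, (∀ v ∈ B, 1 ≤ a v) ∧
        S.height (∑ v ∈ B, a v • v + w) ≤ S.height (∑ v ∈ B, a v • v) := by
  obtain ⟨B, β, hB, hBcard, hβ, hβL, hc⟩ := hP.exists_positive_relation hcard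
  refine ⟨B, hB, hBcard, fun w hw hwP => ?_⟩
  obtain ⟨c, hcw⟩ := hc w
  -- The coefficients `-c` move `w` into the span of `P`; adding a large multiple of the positive
  -- relation `β` keeps it there and makes them positive.
  set T : ℤ := ∑ v ∈ B, |c v| + 1 with hT
  have ha : ∀ v ∈ B, 1 ≤ T * β v - c v := fun v hv => by
    have h1 : |c v| ≤ ∑ v ∈ B, |c v| :=
      Finset.single_le_sum (f := fun v => |c v|) (fun _ _ => abs_nonneg _) hv
    have h2 := le_abs_self (c v)
    have h3 := abs_nonneg (c v)
    have h4 := hβ v hv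
    nlinarith
  refine ⟨fun v => (T * β v - c v).toNat,
    fun v hv => Int.le_toNat (by linarith [ha v hv]) |>.2 (ha v hv), ?_⟩
  have hsum : ∑ v ∈ B, (T * β v - c v).toNat • v = T • ∑ v ∈ B, β v • v - ∑ v ∈ B, c v • v := by
    rw [Finset.smul_sum, ← Finset.sum_sub_distrib]
    refine Finset.sum_congr rfl fun v hv => ?_
    rw [← natCast_zsmul, Int.toNat_of_nonneg (by linarith [ha v hv]), sub_smul, mul_smul]
  set x := ∑ v ∈ B, (T * β v - c v).toNat • v with hx
  have hxL : x + w ∈ Submodule.span ℤ (P : Set (Fin n → ℤ)) := by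
    have : x + w = T • ∑ v ∈ B, β v • v + (w - ∑ v ∈ B, c v • v) := by rw [hsum]; abel
    rw [this]
    exact Submodule.add_mem _ (Submodule.smul_mem _ _ hβL) hcw
  by_contra hcon
  push Not at hcon
  obtain ⟨b, hb⟩ := S.exists_coneAt (x + w)
  have h1 := hb.height_eq
  have h2 := basisDeg_le_height (S := S) hb.1 x
  have h3 := basisDeg_le_one hb.1 hw
  rw [map_add] at h1
  obtain ⟨j, rfl⟩ := mem_range_of_basisDeg_pos hb.1 hw (by omega)
  have hbx : S.ConeAt b x := coneAt_of_height_le hb.1 (by omega)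
  refine hwP (hP.mem_of_repr_ne_zero hxL hb (j := j) ?_)
  have h4 := hbx.2 j
  rw [repr_add_apply, b.repr_self, Finsupp.single_eq_same]
  omega

end IsCentralCollection

/-- If every cone containing `x` contains `x'`, then a generator which does not raise the height of
`x'` does not raise that of `x`. -/
theorem height_add_le_of_forall_coneAt {x' : Fin n → ℤ} (hw : w ∈ S.gens)
    (h : ∀ b, S.ConeAt b x → S.ConeAt b x') (hx' : S.height (x' + w) ≤ S.height x') :
    S.height (x + w) ≤ S.height x := by
  by_contra hcon
  push Not at hcon
  obtain ⟨b, hb⟩ := S.exists_coneAt (x + w)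
  have h1 := hb.height_eq
  have h2 := basisDeg_le_height (S := S) hb.1 x
  have h3 := basisDeg_le_one hb.1 hw
  rw [map_add] at h1
  have h4 := (h b (coneAt_of_height_le hb.1 (by omega))).height_eq
  have h5 := basisDeg_le_height (S := S) hb.1 (x' + w)
  rw [map_add] at h5
  omega

/-- The number of generators outside a central collection of `n + 1 - k` members is bounded in
terms of `k`. -/
theorem exists_card_sdiff_le (k : ℕ) : ∃ A : ℕ, ∀ (n : ℕ) (S : FanoSystem n)
    (P : Finset (Fin n → ℤ)), S.IsCentralCollection P → P.card + k = n + 1 →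
    ∀ G : Finset (Fin n → ℤ), (∀ w ∈ G, w ∈ S.gens ∧ w ∉ P) → G.card ≤ A := by
  choose M hM using exists_bounded_combination
  choose C hC using exists_card_le
  refine ⟨∑ r ∈ Finset.range (2 * k + 1), M r ^ r * C (r * M r), fun n S P hP hcard G hG => ?_⟩
  obtain ⟨B, hB, hBcard, hBw⟩ := hP.exists_incompatible_combination hcard
  set r := B.card with hr
  set g : Fin r → Fin n → ℤ := fun i => (B.equivFin.symm i : Fin n → ℤ) with hg
  have hgB : ∀ i, g i ∈ B := fun i => (B.equivFin.symm i).2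
  have hsum : ∀ a : (Fin n → ℤ) → ℕ, ∑ v ∈ B, a v • v = ∑ i, a (g i) • g i := fun a => by
    rw [← Finset.sum_coe_sort B fun v => a v • v]
    exact (Equiv.sum_comp B.equivFin.symm fun v : B => a v • (v : Fin n → ℤ)).symm
  have hcover : G ⊆ (Fintype.piFinset fun _ : Fin r => Finset.Icc 1 (M r)).biUnion fun m =>
      G.filter fun w => S.height (∑ i, m i • g i + w) ≤ S.height (∑ i, m i • g i) := by
    intro w hw
    obtain ⟨a, ha, haw⟩ := hBw w (hG w hw).1 (hG w hw).2
    rw [hsum] at haw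
    obtain ⟨m, hm, hmb⟩ := hM r n S g (fun i => hB _ (hgB i)) (fun i => a (g i))
      fun i => ha _ (hgB i)
    refine Finset.mem_biUnion.2 ⟨m, Fintype.mem_piFinset.2 fun i => Finset.mem_Icc.2 (hm i),
      Finset.mem_filter.2 ⟨hw, height_add_le_of_forall_coneAt (hG w hw).1 hmb haw⟩⟩
  have hbound : G.card ≤ M r ^ r * C (r * M r) := by
    refine (Finset.card_le_card hcover).trans ((Finset.card_biUnion_le_card_mul _ _
      (C (r * M r)) fun m hm => ?_).trans ?_)
    · refine hC (r * M r) n S (∑ i, m i • g i) ?_ _ fun w hw =>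
        ⟨(hG w (Finset.mem_filter.1 hw).1).1, (Finset.mem_filter.1 hw).2⟩
      refine (S.height_sum_le _ _).trans
        ((Finset.sum_le_card_nsmul _ _ (M r : ℤ) fun j _ => ?_).trans (by simp))
      rw [S.height_nsmul]
      have h1 := height_le_one (hB _ (hgB j))
      have h2 : ((m j : ℕ) : ℤ) ≤ M r := by
        exact_mod_cast (Finset.mem_Icc.1 (Fintype.mem_piFinset.1 hm j)).2
      nlinarith
    · rw [Fintype.card_piFinset]
      simp
  exact hbound.trans (Finset.single_le_sum (f := fun r => M r ^ r * C (r * M r))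
    (fun _ _ => Nat.zero_le _) (Finset.mem_range.2 (by omega)))

end FanoSystem

/-! ### Unimodular cones -/

/-- The `ℝ`-linear extension of a linear form on the lattice. -/
noncomputable def realExtension {n : ℕ} (f : Module.Dual ℤ (Fin n → ℤ)) :
    (Fin n → ℝ) →ₗ[ℝ] ℝ :=
  ∑ i, (f (Pi.single i 1) : ℝ) • LinearMap.proj i

theorem realExtension_apply {n : ℕ} (f : Module.Dual ℤ (Fin n → ℤ)) (x : Fin n → ℝ) :
    realExtension f x = ∑ i, (f (Pi.single i 1) : ℝ) * x i := by
  simp [realExtension]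

theorem realExtension_latticeVec {n : ℕ} (f : Module.Dual ℤ (Fin n → ℤ)) (v : Fin n → ℤ) :
    realExtension f (latticeVec v) = f v := by
  have h : v = ∑ i, v i • Pi.single i (1 : ℤ) := by
    ext j
    simp [Finset.sum_apply, Pi.single_apply]
  rw [realExtension_apply]
  conv_rhs => rw [h]
  rw [map_sum, Int.cast_sum]
  refine Finset.sum_congr rfl fun i _ => ?_
  rw [map_smul, smul_eq_mul, Int.cast_mul, mul_comm]
  rfl

theorem latticeVec_add {n : ℕ} (v w : Fin n → ℤ) :
    latticeVec (v + w) = latticeVec v + latticeVec w := by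
  ext i; simp [latticeVec]

theorem latticeVec_sum {n : ℕ} {ι : Type*} (s : Finset ι) (f : ι → Fin n → ℤ) :
    latticeVec (∑ i ∈ s, f i) = ∑ i ∈ s, latticeVec (f i) := by
  ext j; simp [latticeVec, Finset.sum_apply]

/-- The `i`-th real coordinate with respect to a lattice basis. -/
noncomputable def realCoord {n : ℕ} (b : Module.Basis (Fin n) ℤ (Fin n → ℤ)) (i : Fin n) :
    (Fin n → ℝ) →ₗ[ℝ] ℝ :=
  realExtension (b.coord i)

section LatticeBasis

variable {n : ℕ} (b : Module.Basis (Fin n) ℤ (Fin n → ℤ))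

theorem realCoord_latticeVec (i : Fin n) (v : Fin n → ℤ) :
    realCoord b i (latticeVec v) = b.repr v i :=
  realExtension_latticeVec _ _

theorem realCoord_self (i j : Fin n) :
    realCoord b i (latticeVec (b j)) = if j = i then 1 else 0 := by
  rw [realCoord_latticeVec, b.repr_self, Finsupp.single_apply]
  split_ifs <;> simp

theorem sum_realCoord (x : Fin n → ℝ) : ∑ i, realCoord b i x • latticeVec (b i) = x := by
  have h : ∀ l : Fin n, ∑ i, (b.coord i (Pi.single l 1) : ℝ) • latticeVec (b i) =
      latticeVec (Pi.single l 1) := fun l => by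
    conv_rhs => rw [← b.sum_repr (Pi.single l 1), latticeVec_sum]
    refine Finset.sum_congr rfl fun i _ => ?_
    ext j
    simp [latticeVec]
  simp only [realCoord, realExtension_apply, Finset.sum_smul]
  rw [Finset.sum_comm]
  simp only [mul_comm _ (x _), mul_smul, ← Finset.smul_sum, h]
  ext j
  simp [latticeVec, Finset.sum_apply, Pi.single_apply]

theorem mem_latticeCone_image {I : Set (Fin n)} {x : Fin n → ℝ} :
    x ∈ latticeCone (b '' I) ↔ (∀ i, 0 ≤ realCoord b i x) ∧ ∀ i ∉ I, realCoord b i x = 0 := by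
  constructor
  · intro hx
    induction hx using Submodule.span_induction with
    | mem x hx =>
      obtain ⟨_, ⟨j, hj, rfl⟩, rfl⟩ := hx
      refine ⟨fun i => ?_, fun i hi => ?_⟩
      · rw [realCoord_self]
        split_ifs <;> simp
      · rw [realCoord_self, if_neg]
        rintro rfl
        exact hi hj
    | zero => simp
    | add x y _ _ hx hy =>
      refine ⟨fun i => ?_, fun i hi => ?_⟩
      · rw [map_add]
        exact add_nonneg (hx.1 i) (hy.1 i)
      · rw [map_add, hx.2 i hi, hy.2 i hi, add_zero]
    | smul a x _ hx =>
      have h : ∀ i, realCoord b i (a • x) = a * realCoord b i x := fun i =>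
        map_smul (realCoord b i) (a : ℝ) x
      refine ⟨fun i => ?_, fun i hi => ?_⟩
      · rw [h]
        exact mul_nonneg a.2 (hx.1 i)
      · rw [h, hx.2 i hi, mul_zero]
  · rintro ⟨h0, hI⟩
    rw [← sum_realCoord b x]
    refine Submodule.sum_mem _ fun i _ => ?_
    by_cases hi : i ∈ I
    · exact PointedCone.smul_mem _ (h0 i)
        (PointedCone.subset_hull ⟨b i, ⟨i, hi, rfl⟩, rfl⟩)
    · rw [hI i hi, zero_smul]
      exact Submodule.zero_mem _

theorem mem_latticeCone_range {x : Fin n → ℝ} :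
    x ∈ latticeCone (Set.range b) ↔ ∀ i, 0 ≤ realCoord b i x := by
  rw [← Set.image_univ, mem_latticeCone_image]
  simp

theorem latticeVec_mem_latticeCone_range {v : Fin n → ℤ} :
    latticeVec v ∈ latticeCone (Set.range b) ↔ ∀ i, 0 ≤ b.repr v i := by
  rw [mem_latticeCone_range]
  simp [realCoord_latticeVec]

theorem isFaceOf_latticeCone_range (I : Set (Fin n)) :
    (latticeCone (b '' I)).IsFaceOf (latticeCone (Set.range b)) where
  le x hx := (mem_latticeCone_range b).2 ((mem_latticeCone_image b).1 hx).1
  mem_of_smul_add_mem := by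
    intro x y a hx hy ha hxy
    rw [mem_latticeCone_range] at hx hy
    rw [mem_latticeCone_image] at hxy ⊢
    refine ⟨hx, fun i hi => ?_⟩
    have h := hxy.2 i hi
    rw [map_add, map_smul, smul_eq_mul] at h
    have h1 : a * realCoord b i x = 0 := by
      have := mul_nonneg ha.le (hx i)
      linarith [hy i]
    exact (mul_eq_zero.1 h1).resolve_left ha.ne'

/-- A lattice point of a unimodular cone on which all generators have degree one is a generator. -/
theorem mem_range_of_basisDeg_eq_one {v : Fin n → ℤ} (h0 : ∀ i, 0 ≤ b.repr v i)
    (h1 : basisDeg b v = 1) : v ∈ Set.range b := by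
  rw [basisDeg_apply] at h1
  obtain ⟨i, -, hi⟩ := Finset.exists_ne_zero_of_sum_ne_zero (h1.trans_ne one_ne_zero)
  have hrest : ∀ j, j ≠ i → b.repr v j = 0 := fun j hj => by
    have h2 := Finset.add_sum_erase Finset.univ (fun i => b.repr v i) (Finset.mem_univ i)
    have h3 := Finset.single_le_sum (f := fun i => b.repr v i) (fun j _ => h0 j)
      (Finset.mem_erase.2 ⟨hj, Finset.mem_univ j⟩)
    have h4 := h0 i
    have h5 := h0 j
    omega
  rw [Finset.sum_eq_single i (fun j _ hj => hrest j hj) (by simp)] at h1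
  refine ⟨i, b.ext_elem fun j => ?_⟩
  rw [b.repr_self]
  by_cases hj : j = i
  · rw [hj, h1, Finsupp.single_eq_same]
  · rw [hrest j hj, Finsupp.single_eq_of_ne hj]

theorem isPrimitiveVec_basis (i : Fin n) : IsPrimitiveVec (b i) := by
  intro d w h
  have h1 := congrArg (fun v => b.repr v i) h
  simp only [b.repr_self, Finsupp.single_eq_same, map_smul, Finsupp.smul_apply, smul_eq_mul] at h1
  exact IsUnit.of_mul_eq_one _ h1.symm

end LatticeBasis

/-! ### The facet system of a smooth toric Fano variety -/

/-- In a smooth complete fan, every lattice point lies in a full-dimensional cone. The point is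
approached along a direction outside the spans of the lower-dimensional cones; infinitely many
members of the approximating sequence lie in the same cone. -/
theorem ToricFan.exists_basis_cone {n : ℕ} {F : ToricFan n} (hs : F.IsSmooth) (hc : F.IsComplete)
    (x : Fin n → ℤ) : ∃ b : Module.Basis (Fin n) ℤ (Fin n → ℤ),
      latticeCone (Set.range b) ∈ F.cones ∧ ∀ i, 0 ≤ b.repr x i := by
  classical
  have hfin : Finite F.cones := F.finite
  set spans : Finset (Submodule ℝ (Fin n → ℝ)) :=
    (F.finite.toFinset.image fun σ : PointedCone ℝ (Fin n → ℝ) =>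
      Submodule.span ℝ (σ : Set (Fin n → ℝ))).erase ⊤ with hspans
  obtain ⟨d, hd⟩ : ∃ d, d ∉ ⋃ p ∈ spans, (p : Set (Fin n → ℝ)) :=
    (Set.ne_univ_iff_exists_notMem _).1
      (Subspace.biUnion_ne_univ_of_top_notMem (Finset.notMem_erase _ _))
  choose τ hτ hxτ using fun t : ℕ => hc (latticeVec x + ((t : ℝ) + 1)⁻¹ • d)
  obtain ⟨⟨σ, hσ⟩, hinf⟩ := Finite.exists_infinite_fiber fun t : ℕ => (⟨τ t, hτ t⟩ : F.cones)
  have hinf' := Set.infinite_coe_iff.1 hinf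
  have hmem : ∀ t ∈ (fun t : ℕ => (⟨τ t, hτ t⟩ : F.cones)) ⁻¹' {⟨σ, hσ⟩},
      latticeVec x + ((t : ℝ) + 1)⁻¹ • d ∈ σ := fun t ht => by
    have h1 : τ t = σ := congrArg Subtype.val ht
    exact h1 ▸ hxτ t
  obtain ⟨b, I, rfl⟩ := hs σ hσ
  have hdspan : d ∈ Submodule.span ℝ (latticeCone (b '' I) : Set (Fin n → ℝ)) := by
    obtain ⟨t, ht⟩ := hinf'.nonempty
    obtain ⟨t', ht', htt'⟩ := hinf'.exists_gt t
    have h1 := Submodule.sub_mem _ (Submodule.subset_span (R := ℝ) (hmem t ht))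
      (Submodule.subset_span (R := ℝ) (hmem t' ht'))
    rw [add_sub_add_left_eq_sub, ← sub_smul] at h1
    refine (Submodule.smul_mem_iff _ ?_).1 h1
    refine sub_ne_zero.2 fun h => ?_
    have h2 := inv_injective h
    have h3 : (t : ℝ) = t' := by linarith
    exact htt'.ne (by exact_mod_cast h3)
  have htop : Submodule.span ℝ (latticeCone (b '' I) : Set (Fin n → ℝ)) = ⊤ := by
    by_contra hne
    refine hd (Set.mem_biUnion (x := Submodule.span ℝ (latticeCone (b '' I) : Set _)) ?_ hdspan)
    exact Finset.mem_erase.2 ⟨hne, Finset.mem_image_of_mem _ (F.finite.mem_toFinset.2 hσ)⟩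
  have hI : I = Set.univ := by
    refine Set.eq_univ_of_forall fun i => ?_
    by_contra hi
    have h1 : Submodule.span ℝ (latticeCone (b '' I) : Set (Fin n → ℝ)) ≤
        LinearMap.ker (realCoord b i) :=
      Submodule.span_le.2 fun y hy => ((mem_latticeCone_image b).1 hy).2 i hi
    rw [htop] at h1
    have h2 := LinearMap.mem_ker.1 (h1 (Submodule.mem_top (x := latticeVec (b i))))
    rw [realCoord_self, if_pos rfl] at h2
    exact one_ne_zero h2
  refine ⟨b, by rwa [← Set.image_univ, ← hI], fun i => ?_⟩
  -- A negative coordinate of `x` is at most `-1`, which bounds the members of the infinite fibre.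
  by_contra hneg
  push Not at hneg
  obtain ⟨m, hm⟩ := exists_nat_gt (realCoord b i d)
  obtain ⟨t, ht, hmt⟩ := hinf'.exists_gt m
  have h1 := ((mem_latticeCone_image b).1 (hmem t ht)).1 i
  rw [map_add, map_smul, realCoord_latticeVec, smul_eq_mul] at h1
  have h2 : ((b.repr x i : ℤ) : ℝ) ≤ -1 := by
    have : b.repr x i ≤ -1 := by omega
    exact_mod_cast this
  have h3 : (0 : ℝ) < (t : ℝ) + 1 := by positivity
  have h4 : (1 : ℝ) ≤ ((t : ℝ) + 1)⁻¹ * realCoord b i d := by linarith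
  rw [inv_mul_eq_div, le_div_iff₀ h3] at h4
  have h5 : (m : ℝ) < t := by exact_mod_cast hmt
  linarith

namespace ToricFan

variable {n : ℕ} {F : ToricFan n} {b : Module.Basis (Fin n) ℤ (Fin n → ℤ)}

/-- Full-dimensional cones of a fan are maximal: a larger cone would have them as faces, although
they contain interior points of it. -/
theorem maximal_latticeCone_range (hb : latticeCone (Set.range b) ∈ F.cones) :
    Maximal (· ∈ F.cones) (latticeCone (Set.range b)) := by
  refine ⟨hb, fun τ hτ hle x hx => ?_⟩
  have hface := (F.inter_face τ hτ _ hb).1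
  -- `p` is deep enough in the interior of the smaller cone that `p - x` stays in it.
  rw [inf_eq_right.2 hle] at hface
  set C : ℝ := ∑ i, |realCoord b i x| with hC
  set p : Fin n → ℝ := ∑ j, C • latticeVec (b j) with hp
  have hpi : ∀ i, realCoord b i p = C := fun i => by
    rw [hp, map_sum]
    simp [realCoord_self]
  have hxC : ∀ i, |realCoord b i x| ≤ C := fun i =>
    Finset.single_le_sum (f := fun i => |realCoord b i x|) (fun _ _ => abs_nonneg _)
      (Finset.mem_univ i)
  have h1 : p - x ∈ latticeCone (Set.range b) := (mem_latticeCone_range b).2 fun i => by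
    rw [map_sub, hpi]
    linarith [le_abs_self (realCoord b i x), hxC i]
  refine hface.mem_of_add_mem_left hx (hle h1) ?_
  rw [add_sub_cancel, mem_latticeCone_range]
  intro i
  rw [hpi]
  exact (abs_nonneg _).trans (hxC i)

theorem basis_mem_rayGens (hb : latticeCone (Set.range b) ∈ F.cones) (i : Fin n) :
    b i ∈ F.rayGens := by
  refine ⟨isPrimitiveVec_basis b i, F.face_mem _ hb _ ?_⟩
  rw [← Set.image_singleton]
  exact isFaceOf_latticeCone_range b {i}

/-- Ampleness of the anticanonical divisor, read off at a full-dimensional cone. -/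
theorem mem_range_or_basisDeg_nonpos_of_isAmple (ha : F.IsAmple F.anticanonical)
    (hb : latticeCone (Set.range b) ∈ F.cones) {w : Fin n → ℤ} (hw : w ∈ F.rayGens) :
    w ∈ Set.range b ∨ (latticeVec w ∉ latticeCone (Set.range b) ∧ basisDeg b w ≤ 0) := by
  obtain ⟨m, hm⟩ := ha _ (maximal_latticeCone_range hb)
  have hmb : ∀ i, m (b i) = -1 := fun i =>
    (hm ⟨b i, basis_mem_rayGens hb i⟩).1 (PointedCone.subset_hull ⟨b i, ⟨i, rfl⟩, rfl⟩)
  have hdeg : m = -basisDeg b := b.ext fun i => by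
    rw [hmb, LinearMap.neg_apply, basisDeg_self]
  have hmw := hm ⟨w, hw⟩
  simp only [hdeg, LinearMap.neg_apply, anticanonical] at hmw
  by_cases hwb : latticeVec w ∈ latticeCone (Set.range b)
  · left
    refine mem_range_of_basisDeg_eq_one b ((latticeVec_mem_latticeCone_range b).1 hwb) ?_
    have := hmw.1 hwb
    omega
  · right
    have := hmw.2 hwb
    exact ⟨hwb, by omega⟩

/-- The facet system of a smooth toric Fano variety. -/
def toFanoSystem (hF : F.IsSmoothFano) : FanoSystem n where
  gens := F.rayGens
  facets := {b | latticeCone (Set.range b) ∈ F.cones}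
  facet_gens _ hb i := basis_mem_rayGens hb i
  gens_facet b hb w hw := by
    rw [← basisDeg_apply]
    exact (mem_range_or_basisDeg_nonpos_of_isAmple hF.ample hb hw).imp_right And.right
  zero_notMem h := by
    have := h.1 2 0 (by simp)
    exact absurd this (by decide)
  cover := exists_basis_cone hF.smooth hF.complete

/-- The facet in question is a cone at the sum of the other members of `P`: it meets the cone over
these members in a face, which contains their sum and hence each of them. -/
theorem isCentralCollection_of_isPrimitiveRelation (hF : F.IsSmoothFano) {P : Finset (Fin n → ℤ)}
    (hP : F.IsPrimitiveRelation P 0) : (toFanoSystem hF).IsCentralCollection P where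
  nonempty := by
    rw [Finset.nonempty_iff_ne_empty]
    rintro rfl
    -- The zero cone, generated by the empty set, is a face of any full-dimensional cone.
    refine hP.primitive.not_cone ?_
    obtain ⟨b, hb, -⟩ := exists_basis_cone hF.smooth hF.complete 0
    have := F.face_mem _ hb _ (isFaceOf_latticeCone_range b ∅)
    simpa using this
  subset_gens v hv := hP.primitive.subset_rayGens hv
  sum_eq_zero := by simpa using hP.sum_eq
  exists_facet i hi := by
    obtain ⟨b, hb, hbx⟩ := exists_basis_cone hF.smooth hF.complete (∑ v ∈ P.erase i, v)
    have hσ := hP.primitive.cone_of_ssubset _ (Finset.erase_ssubset hi)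
    have hface := (F.inter_face _ hσ _ hb).1
    have hmem : ∀ v ∈ P.erase i, latticeVec v ∈ latticeCone (P.erase i : Set (Fin n → ℤ)) :=
      fun v hv => PointedCone.subset_hull ⟨v, hv, rfl⟩
    refine ⟨b, hb, fun v hv => ?_⟩
    have hrest : latticeVec (∑ u ∈ (P.erase i).erase v, u) ∈
        latticeCone (P.erase i : Set (Fin n → ℤ)) := by
      rw [latticeVec_sum]
      exact Submodule.sum_mem _ fun u hu => hmem u (Finset.mem_of_mem_erase hu)
    have hsum : latticeVec v + latticeVec (∑ u ∈ (P.erase i).erase v, u) ∈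
        latticeCone (P.erase i : Set (Fin n → ℤ)) ⊓ latticeCone (Set.range b) := by
      refine ⟨Submodule.add_mem _ (hmem v hv) hrest, ?_⟩
      rw [← latticeVec_add, Finset.add_sum_erase _ (fun u => u) hv]
      exact (latticeVec_mem_latticeCone_range b).2 hbx
    have hvb := (hface.mem_of_add_mem_left (hmem v hv) hrest hsum).2
    exact (mem_range_or_basisDeg_nonpos_of_isAmple hF.ample hb
      (hP.primitive.subset_rayGens (Finset.mem_of_mem_erase hv))).resolve_right
        fun h => h.1 hvb

/-! ### The Picard rank -/

theorem picardRank_add_le (hF : F.IsSmoothFano) (hfin : F.rayGens.Finite) :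
    F.picardRank + n ≤ F.rayGens.ncard := by
  have : Finite F.rayGens := hfin
  have : Fintype F.rayGens := Fintype.ofFinite _
  obtain ⟨b, hb, -⟩ := exists_basis_cone hF.smooth hF.complete 0
  have hinj : Function.Injective F.charDiv := by
    refine (injective_iff_map_eq_zero _).2 fun m hm => b.ext fun i => ?_
    exact congrFun hm ⟨b i, basis_mem_rayGens hb i⟩
  have hle : LinearMap.range F.charDiv ≤ F.cartier := by
    rintro _ ⟨m, rfl⟩
    exact fun σ _ => ⟨m, fun v _ => rfl⟩
  have h1 := Submodule.finrank_quotient_add_finrank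
    ((LinearMap.range F.charDiv).submoduleOf F.cartier)
  rw [(Submodule.submoduleOfEquivOfLe hle).finrank_eq, LinearMap.finrank_range_of_inj hinj] at h1
  have h2 : Module.finrank ℤ (Module.Dual ℤ (Fin n → ℤ)) = n := by
    rw [Module.finrank_eq_card_basis b.dualBasis, Fintype.card_fin]
  have h3 := Submodule.finrank_le F.cartier
  have h4 : Module.finrank ℤ F.TDivisor = F.rayGens.ncard := by
    rw [Module.finrank_fintype_fun_eq_card, ← Nat.card_eq_fintype_card, Nat.card_coe_set_eq]
  change F.picardRank + _ = _ at h1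
  omega

end ToricFan

theorem theorem3p2 (k : ℕ) :
    ∃ A : ℕ, ∀ (n : ℕ) (F : ToricFan n), F.IsSmoothFano →
      ∀ P : Finset (Fin n → ℤ), F.IsPrimitiveRelation P 0 → P.card + k = n + 1 →
        F.picardRank ≤ A := by
  obtain ⟨A, hA⟩ := FanoSystem.exists_card_sdiff_le k
  refine ⟨A + 1, fun n F hF P hP hcard => ?_⟩
  have hbound := hA n _ P (ToricFan.isCentralCollection_of_isPrimitiveRelation hF hP) hcard
  have hfin' : (F.rayGens \ P).Finite := by
    by_contra hinf
    obtain ⟨G, hG, hGcard⟩ := Set.Infinite.exists_subset_card_eq hinf (A + 1)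
    have := hbound G fun w hw => ⟨(hG hw).1, fun h => (hG hw).2 h⟩
    omega
  have hncard : (F.rayGens \ P).ncard ≤ A := by
    rw [Set.ncard_eq_toFinset_card _ hfin']
    refine hbound _ fun w hw => ?_
    have hw' := hfin'.mem_toFinset.1 hw
    exact ⟨hw'.1, fun h => hw'.2 h⟩
  have hfin : F.rayGens.Finite := (hfin'.union P.finite_toSet).subset fun w hw => by
    by_cases h : w ∈ (P : Set (Fin n → ℤ))
    · exact Or.inr h
    · exact Or.inl ⟨hw, h⟩
  have h1 := ToricFan.picardRank_add_le hF hfin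
  have h2 := Set.ncard_le_ncard_sdiff_add_ncard F.rayGens P P.finite_toSet
  rw [Set.ncard_coe_finset] at h2
  omega
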